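/- \textbf{Theorem.} Let $\mathcal H$ be a real or complex Hilbert space and let $T$ be a densely defined positive symmetric operator in $\mathcal H$, i.e. a linear operator defined on a dense linear subspace $\operatorname{dom}T$ of $\mathcal H$ with $\langle Tf,g\rangle=\langle f,Tg\rangle$ and $\langle Tf,f\rangle\ge 0$ for all $f,g\in\operatorname{dom}T$. Let $\mathcal E_T$ be the Hilbert space completion of $\operatorname{ran}T$ with respect to the inner product $\langle Tf,Th\rangle_T:=\langle Tf,h\rangle$ $(f,h\in\operatorname{dom}T)$, let $Q_T:\operatorname{dom}T\subseteq\mathcal H\to\mathcal E_T$ be the operator $Q_Tf:=Tf$, and let $T_F:=Q_T^{*}Q_T^{**}$ be the Friedrichs extension of $T$. Let $S$ be a positive self-adjoint extension of $T$, and let $S^{1/2}$ denote its unique positive self-adjoint square root. Then the following statements are equivalent: \begin{enumerate} \item[(i)] $S=T_F$; \item[(ii)] $\ker(I+T^*)\cap\operatorname{dom}S^{1/2}=\{0\}$. \end{enumerate} -/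

import Mathlib

open scoped InnerProductSpace LinearPMap

noncomputable section

namespace UnboundedOp

variable {𝕜 H K L : Type*} [RCLike 𝕜]
variable [NormedAddCommGroup H] [InnerProductSpace 𝕜 H]
variable [NormedAddCommGroup K] [InnerProductSpace 𝕜 K]
variable [NormedAddCommGroup L] [InnerProductSpace 𝕜 L]

/-- The composition `B A` of two partially defined operators, on its natural domain
`{x ∈ dom A | A x ∈ dom B}`. -/
def mul (B : K →ₗ.[𝕜] L) (A : H →ₗ.[𝕜] K) : H →ₗ.[𝕜] L where
  domain := (B.domain.comap A.toFun).map A.domain.subtype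
  toFun :=
    { toFun := fun x =>
        B ⟨A ⟨x, by obtain ⟨y, -, h⟩ := x.2; exact h ▸ y.2⟩, by
          obtain ⟨x, y, hy, rfl⟩ := x; exact hy⟩
      map_add' := by
        intro x y
        rw [← LinearPMap.map_add]
        congr 1
        apply Subtype.ext
        exact LinearPMap.map_add A ⟨x, _⟩ ⟨y, _⟩
      map_smul' := by
        intro c x
        rw [RingHom.id_apply, ← LinearPMap.map_smul]
        congr 1
        apply Subtype.ext
        exact LinearPMap.map_smul A c ⟨x, _⟩ }

/-- Membership in the domain of a composition. -/
theorem mem_mul_domain {B : K →ₗ.[𝕜] L} {A : H →ₗ.[𝕜] K} {x : H} :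
    x ∈ (mul B A).domain ↔ ∃ hx : x ∈ A.domain, A ⟨x, hx⟩ ∈ B.domain := by
  constructor
  · rintro ⟨y, hy, rfl⟩
    exact ⟨y.2, hy⟩
  · rintro ⟨hx, h⟩
    exact ⟨⟨x, hx⟩, h, rfl⟩

/-- The value of a composition. -/
theorem mul_apply {B : K →ₗ.[𝕜] L} {A : H →ₗ.[𝕜] K} {x : H}
    (hx : x ∈ A.domain) (h : A ⟨x, hx⟩ ∈ B.domain) :
    mul B A ⟨x, mem_mul_domain.2 ⟨hx, h⟩⟩ = B ⟨A ⟨x, hx⟩, h⟩ := rfl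

/-- The kernel of a partially defined operator, as a subspace of the ambient space. -/
def ker (A : H →ₗ.[𝕜] K) : Submodule 𝕜 H :=
  (LinearMap.ker A.toFun).map A.domain.subtype

/-- The everywhere defined identity operator `I`. -/
def one (𝕜 H : Type*) [RCLike 𝕜] [NormedAddCommGroup H] [InnerProductSpace 𝕜 H] :
    H →ₗ.[𝕜] H :=
  (LinearMap.id : H →ₗ[𝕜] H).toPMap ⊤

/-- A positive (symmetric) operator. Symmetry is part of the definition, since the scalars may
be real. The domain need not be dense. -/
structure IsPositive (A : H →ₗ.[𝕜] H) : Prop where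
  symm : ∀ f g : A.domain, ⟪A f, (g : H)⟫_𝕜 = ⟪(f : H), A g⟫_𝕜
  nonneg : ∀ f : A.domain, 0 ≤ RCLike.re ⟪A f, (f : H)⟫_𝕜

/-- `R` is a positive self-adjoint square root of `A`: `R` is positive and self-adjoint, and
`R R = A`, including equality of domains. -/
structure IsPosSqrt [CompleteSpace H] (R A : H →ₗ.[𝕜] H) : Prop where
  selfAdjoint : IsSelfAdjoint R
  pos : IsPositive R
  mul_self : mul R R = A

open Classical in
/-- The square root `A^{1/2}` of a positive self-adjoint operator `A`: the (unique) positive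
self-adjoint operator whose square is `A`. (Junk value `0` if there is no such operator.) -/
def sqrt [CompleteSpace H] (A : H →ₗ.[𝕜] H) : H →ₗ.[𝕜] H :=
  if h : ∃ R : H →ₗ.[𝕜] H, IsPosSqrt R A then h.choose else 0

/-! ### The energy space and the Friedrichs extension -/

/-- The range of a densely defined positive operator `T`, as a type without the topology of `H`,
to be equipped with the energy inner product. -/
def EnergyRange (T : H →ₗ.[𝕜] H) (_hd : Dense (T.domain : Set H)) (_hT : IsPositive T) : Type _ :=
  LinearMap.range T.toFun

section Energy

variable (T : H →ₗ.[𝕜] H) (hd : Dense (T.domain : Set H)) (hT : IsPositive T)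

instance : AddCommGroup (EnergyRange T hd hT) :=
  inferInstanceAs (AddCommGroup (LinearMap.range T.toFun))

instance : Module 𝕜 (EnergyRange T hd hT) :=
  inferInstanceAs (Module 𝕜 (LinearMap.range T.toFun))

/-- The map `f ↦ T f` from `dom T` onto `ran T`. -/
def toEnergyRange : T.domain →ₗ[𝕜] EnergyRange T hd hT :=
  T.toFun.rangeRestrict

/-- The inclusion of `ran T` in `H`. -/
def energyRangeVal : EnergyRange T hd hT →ₗ[𝕜] H :=
  (LinearMap.range T.toFun).subtype

theorem energyRangeVal_toEnergyRange (f : T.domain) :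
    energyRangeVal T hd hT (toEnergyRange T hd hT f) = T f := rfl

theorem energyRangeVal_injective : Function.Injective (energyRangeVal T hd hT) :=
  Subtype.val_injective

theorem toEnergyRange_surjective : Function.Surjective (toEnergyRange T hd hT) :=
  T.toFun.surjective_rangeRestrict

/-- The energy inner product on `ran T`: the inner product of `T f` and `T h` is `⟪T f, h⟫`
(for an arbitrary preimage `h` of the second vector; see `energyInner_apply`). -/
def energyInner (u v : EnergyRange T hd hT) : 𝕜 :=
  ⟪energyRangeVal T hd hT u, ((toEnergyRange_surjective T hd hT v).choose : H)⟫_𝕜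

/-- The energy inner product does not depend on the choice of the preimage. -/
theorem energyInner_apply (f h : T.domain) :
    energyInner T hd hT (toEnergyRange T hd hT f) (toEnergyRange T hd hT h) =
      ⟪T f, (h : H)⟫_𝕜 := by
  have hk := (toEnergyRange_surjective T hd hT (toEnergyRange T hd hT h)).choose_spec
  have hk' := congrArg (energyRangeVal T hd hT) hk
  rw [energyRangeVal_toEnergyRange, energyRangeVal_toEnergyRange] at hk'
  rw [energyInner, energyRangeVal_toEnergyRange, hT.symm, hT.symm, hk']

/-- Definiteness: `⟪T f, f⟫ = 0` implies `T f = 0`. -/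
theorem apply_eq_zero_of_inner_eq_zero {T : H →ₗ.[𝕜] H} (hd : Dense (T.domain : Set H))
    (hT : IsPositive T) (f : T.domain) (hf : ⟪T f, (f : H)⟫_𝕜 = 0) : T f = 0 := by
  let c : PreInnerProductSpace.Core 𝕜 T.domain :=
    { inner := fun x y => ⟪T x, (y : H)⟫_𝕜
      conj_inner_symm := fun x y => by rw [inner_conj_symm, hT.symm]
      re_inner_nonneg := fun x => hT.nonneg x
      add_left := fun x y z => by
        change ⟪T (x + y), (z : H)⟫_𝕜 = _
        rw [LinearPMap.map_add, inner_add_left]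
      smul_left := fun x y r => by
        change ⟪T (r • x), (y : H)⟫_𝕜 = _
        rw [LinearPMap.map_smul, inner_smul_left] }
  refine hd.eq_zero_of_inner_left 𝕜 (fun v hv => ?_)
  have h := @InnerProductSpace.Core.inner_mul_inner_self_le 𝕜 T.domain _ _ _ c f ⟨v, hv⟩
  change ‖⟪T f, v⟫_𝕜‖ * ‖⟪T ⟨v, hv⟩, (f : H)⟫_𝕜‖ ≤
    RCLike.re ⟪T f, (f : H)⟫_𝕜 * RCLike.re ⟪T ⟨v, hv⟩, v⟫_𝕜 at h
  rw [hT.symm ⟨v, hv⟩ f, norm_inner_symm v (T f), hf, map_zero, zero_mul] at h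
  have h0 : ‖⟪T f, v⟫_𝕜‖ = 0 := mul_self_eq_zero.1 (le_antisymm h (mul_self_nonneg _))
  exact norm_eq_zero.1 h0

/-- The energy inner product makes `ran T` a pre-Hilbert space. -/
@[reducible] def energyCore : InnerProductSpace.Core 𝕜 (EnergyRange T hd hT) where
  inner := energyInner T hd hT
  conj_inner_symm u v := by
    obtain ⟨f, rfl⟩ := toEnergyRange_surjective T hd hT u
    obtain ⟨h, rfl⟩ := toEnergyRange_surjective T hd hT v
    rw [energyInner_apply, energyInner_apply, inner_conj_symm, hT.symm]
  re_inner_nonneg u := by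
    obtain ⟨f, rfl⟩ := toEnergyRange_surjective T hd hT u
    rw [energyInner_apply]
    exact hT.nonneg f
  add_left u v w := by
    simp only [energyInner, map_add, inner_add_left]
  smul_left u v r := by
    simp only [energyInner, map_smul, inner_smul_left]
  definite u h := by
    obtain ⟨f, rfl⟩ := toEnergyRange_surjective T hd hT u
    rw [energyInner_apply] at h
    apply energyRangeVal_injective T hd hT
    rw [energyRangeVal_toEnergyRange, map_zero]
    exact apply_eq_zero_of_inner_eq_zero hd hT f h

instance : NormedAddCommGroup (EnergyRange T hd hT) :=
  @InnerProductSpace.Core.toNormedAddCommGroup 𝕜 _ _ _ _ (energyCore T hd hT)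

instance : InnerProductSpace 𝕜 (EnergyRange T hd hT) :=
  InnerProductSpace.ofCore (energyCore T hd hT).toCore

theorem inner_toEnergyRange (f h : T.domain) :
    ⟪toEnergyRange T hd hT f, toEnergyRange T hd hT h⟫_𝕜 = ⟪T f, (h : H)⟫_𝕜 :=
  energyInner_apply T hd hT f h

/-- The energy space of `T`: the Hilbert space completion of `ran T` with respect to the energy
inner product. -/
abbrev EnergySpace : Type _ := UniformSpace.Completion (EnergyRange T hd hT)

/-- The operator `f ↦ T f`, with domain `dom T`, from `H` to the energy space of `T`. -/
def energyOp : H →ₗ.[𝕜] EnergySpace T hd hT where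
  domain := T.domain
  toFun :=
    (UniformSpace.Completion.toComplL (𝕜 := 𝕜) (E := EnergyRange T hd hT)).toLinearMap ∘ₗ
      toEnergyRange T hd hT

/-- The Friedrichs extension `Q* Q**` of the densely defined positive symmetric operator `T`,
where `Q` is the operator `f ↦ T f` from `dom T` to the energy space of `T`. -/
def friedrichs [CompleteSpace H] : H →ₗ.[𝕜] H :=
  mul (energyOp T hd hT)† (energyOp T hd hT)††

end Energy

end UnboundedOp

end

/-! Let `R` be a positive self-adjoint square root of `S`, `J` its restriction to `dom T`, and `Q`
the energy operator. For `f`, `h` in `dom T`, `⟪J f, J h⟫ = ⟪T f, h⟫ = ⟪Q f, Q h⟫`, so convergence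
of `Q uₙ` and of `J uₙ` are equivalent although the target spaces differ.

A pair `(g, R g)` is orthogonal to the graph of `J` exactly when `⟪T f, g⟫ = -⟪f, g⟫` for all `f` in
`dom T`, that is, when `T* g = -g`. Hence (ii) makes `dom T` a core of `R`
(`IsPosSqrt.graph_le_closure`). Limits along `dom T` then identify `R R` with `Q* Q**`
(`IsPosSqrt.eq_friedrichs`).

Conversely, if `S = Q* Q**`, each `x` in `dom S` is a graph-norm limit of elements of `dom T`,
because the graph of `Q**` lies in the closure of that of `Q`. So any `g` in the intersection is
orthogonal to `ran (I + S)`, which is the whole space.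

The square root is built from `B = (I + S)⁻¹` as `R = D C⁻¹` with `C² = B` and `D² = 1 - B`, over
real and complex scalars alike. Its uniqueness is not needed. -/

open scoped InnerProductSpace LinearPMap

noncomputable section

namespace UnboundedOp

open Filter Topology

/-! ### Square roots of bounded operators by iteration. -/

section Bounded

variable {𝕜 H : Type*} [RCLike 𝕜] [NormedAddCommGroup H] [InnerProductSpace 𝕜 H]

/-- The iteration `Y ↦ (X + Y²) / 2`, whose limit `Y` satisfies `(1 - Y)² = 1 - X`. -/
def sqrtIter (X : H →L[𝕜] H) : ℕ → (H →L[𝕜] H)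
  | 0 => 0
  | n + 1 => (2⁻¹ : 𝕜) • (X + sqrtIter X n * sqrtIter X n)

/-- The scalar majorant of `sqrtIter`. -/
def sqrtMajorant : ℕ → ℝ
  | 0 => 0
  | n + 1 => 2⁻¹ * (1 + sqrtMajorant n * sqrtMajorant n)

theorem sqrtMajorant_nonneg (n : ℕ) : 0 ≤ sqrtMajorant n := by
  induction n with
  | zero => exact le_rfl
  | succ n ih => simp only [sqrtMajorant]; positivity

theorem sqrtMajorant_le_one (n : ℕ) : sqrtMajorant n ≤ 1 := by
  induction n with
  | zero => exact zero_le_one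
  | succ n ih =>
    have := sqrtMajorant_nonneg n
    simp only [sqrtMajorant]
    nlinarith

theorem sqrtMajorant_monotone : Monotone sqrtMajorant := by
  refine monotone_nat_of_le_succ fun n => ?_
  simp only [sqrtMajorant]
  nlinarith [sq_nonneg (sqrtMajorant n - 1)]

theorem norm_half_smul_le {A : H →L[𝕜] H} {c : ℝ} (h : ‖A‖ ≤ c) :
    ‖(2⁻¹ : 𝕜) • A‖ ≤ 2⁻¹ * c := by
  rw [norm_smul, norm_inv, RCLike.norm_ofNat]
  gcongr

theorem norm_sqrtIter_le {X : H →L[𝕜] H} (hX : ‖X‖ ≤ 1) (n : ℕ) :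
    ‖sqrtIter X n‖ ≤ sqrtMajorant n := by
  induction n with
  | zero => simp [sqrtIter, sqrtMajorant]
  | succ n ih =>
    refine norm_half_smul_le ((norm_add_le _ _).trans (add_le_add hX ?_))
    exact (norm_mul_le _ _).trans (mul_self_le_mul_self (norm_nonneg _) ih)

theorem commute_sqrtIter {X D : H →L[𝕜] H} (h : Commute X D) (n : ℕ) :
    Commute (sqrtIter X n) D := by
  induction n with
  | zero => exact Commute.zero_left _
  | succ n ih => exact (h.add_left (ih.mul_left ih)).smul_left _

theorem isSelfAdjoint_sqrtIter [CompleteSpace H] {X : H →L[𝕜] H} (h : IsSelfAdjoint X) (n : ℕ) :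
    IsSelfAdjoint (sqrtIter X n) := by
  induction n with
  | zero => exact IsSelfAdjoint.zero _
  | succ n ih =>
    change star ((2⁻¹ : 𝕜) • (X + sqrtIter X n * sqrtIter X n)) = _
    simp only [star_smul, star_add, star_mul, h.star_eq, ih.star_eq, star_inv₀, star_ofNat]
    rfl

/-- The iterates commute, so a difference of squares factors as sum times difference. The majorant
is the same iteration at the scalar `1` and obeys the same identity, so the bound propagates by
induction. -/
theorem norm_sqrtIter_succ_sub_le {X : H →L[𝕜] H} (hX : ‖X‖ ≤ 1) (n : ℕ) :
    ‖sqrtIter X (n + 1) - sqrtIter X n‖ ≤ sqrtMajorant (n + 1) - sqrtMajorant n := by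
  induction n with
  | zero =>
    have := norm_sqrtIter_le hX 1
    simpa [sqrtIter, sqrtMajorant] using this
  | succ n ih =>
    have hc : Commute (sqrtIter X (n + 1)) (sqrtIter X n) :=
      commute_sqrtIter (commute_sqrtIter (Commute.refl X) n).symm (n + 1)
    have e : sqrtIter X (n + 2) - sqrtIter X (n + 1) = (2⁻¹ : 𝕜) •
        ((sqrtIter X (n + 1) + sqrtIter X n) * (sqrtIter X (n + 1) - sqrtIter X n)) := by
      rw [← hc.mul_self_sub_mul_self_eq]
      change (2⁻¹ : 𝕜) • (X + sqrtIter X (n + 1) * sqrtIter X (n + 1)) -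
        (2⁻¹ : 𝕜) • (X + sqrtIter X n * sqrtIter X n) = _
      rw [← smul_sub, add_sub_add_left_eq_sub]
    have e' : sqrtMajorant (n + 2) - sqrtMajorant (n + 1) = 2⁻¹ *
        ((sqrtMajorant (n + 1) + sqrtMajorant n) * (sqrtMajorant (n + 1) - sqrtMajorant n)) := by
      change 2⁻¹ * (1 + sqrtMajorant (n + 1) * sqrtMajorant (n + 1)) -
        2⁻¹ * (1 + sqrtMajorant n * sqrtMajorant n) = _
      ring
    rw [e, e']
    refine norm_half_smul_le ((norm_mul_le _ _).trans ?_)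
    refine mul_le_mul ((norm_add_le _ _).trans ?_) ih (norm_nonneg _) ?_
    · exact add_le_add (norm_sqrtIter_le hX _) (norm_sqrtIter_le hX _)
    · exact add_nonneg (sqrtMajorant_nonneg _) (sqrtMajorant_nonneg _)

theorem norm_sqrtIter_sub_le {X : H →L[𝕜] H} (hX : ‖X‖ ≤ 1) {m n : ℕ} (h : m ≤ n) :
    ‖sqrtIter X n - sqrtIter X m‖ ≤ sqrtMajorant n - sqrtMajorant m := by
  induction n, h using Nat.le_induction with
  | base => simp
  | succ n _ ih =>
    calc _ = ‖(sqrtIter X (n + 1) - sqrtIter X n) + (sqrtIter X n - sqrtIter X m)‖ := by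
          rw [sub_add_sub_cancel]
      _ ≤ _ := norm_add_le _ _
      _ ≤ (sqrtMajorant (n + 1) - sqrtMajorant n) + (sqrtMajorant n - sqrtMajorant m) :=
          add_le_add (norm_sqrtIter_succ_sub_le hX n) ih
      _ = _ := sub_add_sub_cancel _ _ _

theorem cauchySeq_sqrtIter {X : H →L[𝕜] H} (hX : ‖X‖ ≤ 1) : CauchySeq (sqrtIter X) := by
  have hs : CauchySeq sqrtMajorant :=
    (tendsto_atTop_ciSup sqrtMajorant_monotone
      ⟨1, by rintro _ ⟨n, rfl⟩; exact sqrtMajorant_le_one n⟩).cauchySeq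
  rw [Metric.cauchySeq_iff'] at hs ⊢
  intro ε hε
  obtain ⟨N, hN⟩ := hs ε hε
  refine ⟨N, fun n hn => lt_of_le_of_lt ?_ (hN n hn)⟩
  rw [dist_eq_norm, Real.dist_eq]
  exact (norm_sqrtIter_sub_le hX hn).trans (le_abs_self _)

/-- A self-adjoint operator `A` with `‖1 - A‖ ≤ 1` has a self-adjoint square root `C` with
`‖1 - C‖ ≤ 1` that commutes with every operator commuting with `A`. -/
theorem exists_bounded_sqrt [CompleteSpace H] {A : H →L[𝕜] H}
    (hA : IsSelfAdjoint A) (h1 : ‖1 - A‖ ≤ 1) :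
    ∃ C : H →L[𝕜] H, IsSelfAdjoint C ∧ ‖1 - C‖ ≤ 1 ∧ C * C = A ∧
      ∀ D, Commute A D → Commute C D := by
  obtain ⟨Y, hY⟩ := cauchySeq_tendsto_of_complete (cauchySeq_sqrtIter h1)
  have hfix : Y = (2⁻¹ : 𝕜) • ((1 - A) + Y * Y) :=
    tendsto_nhds_unique ((tendsto_add_atTop_iff_nat 1).2 hY)
      ((tendsto_const_nhds.add (hY.mul hY)).const_smul _)
  have hsa : IsSelfAdjoint Y :=
    isClosed_eq continuous_star continuous_id |>.mem_of_tendsto hY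
      (Eventually.of_forall (isSelfAdjoint_sqrtIter ((IsSelfAdjoint.one _).sub hA)))
  refine ⟨1 - Y, (IsSelfAdjoint.one _).sub hsa, ?_, ?_, fun D hD => ?_⟩
  · rw [sub_sub_cancel]
    exact le_of_tendsto hY.norm (Eventually.of_forall fun n =>
      (norm_sqrtIter_le h1 n).trans (sqrtMajorant_le_one n))
  · have h2 : Y + Y = (1 - A) + Y * Y := by
      conv_lhs => rw [hfix]
      rw [← add_smul, ← two_mul, mul_inv_cancel₀ two_ne_zero, one_smul]
    have h3 : A = 1 - (Y + Y) + Y * Y := by rw [h2]; abel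
    rw [h3]; noncomm_ring
  · refine (Commute.one_left _).sub_left ?_
    have hX : Commute (1 - A) D := (Commute.one_left _).sub_left hD
    refine tendsto_nhds_unique (hY.mul_const D) ?_
    simpa only [(commute_sqrtIter hX _).eq] using hY.const_mul D

/-- Cauchy–Schwarz applied to `⟪C x, x⟫ = ‖x‖² - ⟪(1 - C) x, x⟫`. -/
theorem re_inner_apply_nonneg_of_norm_one_sub_le {C : H →L[𝕜] H} (h : ‖1 - C‖ ≤ 1) (x : H) :
    0 ≤ RCLike.re ⟪C x, x⟫_𝕜 := by
  have e : C x = x - (1 - C) x := by simp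
  rw [e, inner_sub_left, map_sub, inner_self_eq_norm_mul_norm, sub_nonneg]
  refine (re_inner_le_norm _ _).trans ?_
  gcongr
  exact ((1 - C).le_opNorm x).trans (by nlinarith [norm_nonneg x])

/-- Commuting square roots `C`, `D` of `B`, `1 - B`. -/
theorem exists_commuting_sqrts [CompleteSpace H] {B : H →L[𝕜] H}
    (hB : IsSelfAdjoint B) (h0 : ‖B‖ ≤ 1)
    (h1 : ‖1 - B‖ ≤ 1) :
    ∃ C D : H →L[𝕜] H, IsSelfAdjoint C ∧ IsSelfAdjoint D ∧ C * C = B ∧ D * D = 1 - B ∧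
      Commute C D ∧ ∀ x, 0 ≤ RCLike.re ⟪D x, C x⟫_𝕜 := by
  obtain ⟨C, hC, hC1, hCC, hCcomm⟩ := exists_bounded_sqrt hB h1
  obtain ⟨D, hD, hD1, hDD, hDcomm⟩ :=
    exists_bounded_sqrt ((IsSelfAdjoint.one _).sub hB) (by rwa [sub_sub_cancel])
  -- A fourth root `E` of `B`: since it commutes with `D`, it turns `⟪D x, C x⟫` into `⟪D (E x), E
  -- x⟫`, and positivity of `D` applies.
  obtain ⟨E, hE, -, hEE, hEcomm⟩ := exists_bounded_sqrt hC hC1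
  have hBC : Commute B C := by rw [← hCC]; exact (Commute.refl C).mul_left (Commute.refl C)
  have hDC : Commute D C := hDcomm C ((Commute.one_left C).sub_left hBC)
  have hED : Commute E D := hEcomm D hDC.symm
  refine ⟨C, D, hC, hD, hCC, hDD, hDC.symm, fun x => ?_⟩
  have e : ⟪D x, C x⟫_𝕜 = ⟪D (E x), E x⟫_𝕜 := by
    have hx : D (E x) = E (D x) := (congrArg (· x) hED.eq).symm
    rw [hx, ← hEE]
    exact (hE.isSymmetric (D x) (E x)).symm
  rw [e]
  exact re_inner_apply_nonneg_of_norm_one_sub_le hD1 _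

end Bounded

/-! ### Graphs of compositions and adjoints. -/

section Graph

variable {𝕜 H K L : Type*} [RCLike 𝕜]
variable [NormedAddCommGroup H] [InnerProductSpace 𝕜 H]
variable [NormedAddCommGroup K] [InnerProductSpace 𝕜 K]
variable [NormedAddCommGroup L] [InnerProductSpace 𝕜 L]

theorem mk_mem_graph {A : H →ₗ.[𝕜] K} {x : H} {y : K} :
    (x, y) ∈ A.graph ↔ ∃ hx : x ∈ A.domain, A ⟨x, hx⟩ = y := by
  simp only [LinearPMap.mem_graph_iff]
  constructor
  · rintro ⟨⟨a, ha⟩, rfl, rfl⟩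
    exact ⟨ha, rfl⟩
  · rintro ⟨hx, rfl⟩
    exact ⟨⟨x, hx⟩, rfl, rfl⟩

theorem mem_graph_mul {B : K →ₗ.[𝕜] L} {A : H →ₗ.[𝕜] K} {x : H} {z : L} :
    (x, z) ∈ (mul B A).graph ↔ ∃ y, (x, y) ∈ A.graph ∧ (y, z) ∈ B.graph := by
  simp only [mk_mem_graph]
  constructor
  · rintro ⟨hx, rfl⟩
    obtain ⟨h1, h2⟩ := mem_mul_domain.1 hx
    exact ⟨_, ⟨h1, rfl⟩, h2, (mul_apply h1 h2).symm⟩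
  · rintro ⟨_, ⟨h1, rfl⟩, h2, rfl⟩
    exact ⟨mem_mul_domain.2 ⟨h1, h2⟩, mul_apply h1 h2⟩

theorem mem_graph_adjoint [CompleteSpace H] {A : H →ₗ.[𝕜] K} (hA : Dense (A.domain : Set H))
    {y : K} {z : H} :
    (y, z) ∈ A†.graph ↔ ∀ a b, (a, b) ∈ A.graph → ⟪b, y⟫_𝕜 = ⟪a, z⟫_𝕜 := by
  rw [LinearPMap.adjoint_graph_eq_graph_adjoint hA, Submodule.mem_adjoint_iff]
  simp only [sub_eq_zero]

theorem mem_graph_of_isSelfAdjoint [CompleteSpace H] {A : H →ₗ.[𝕜] H} (hA : IsSelfAdjoint A)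
    {y z : H} : (y, z) ∈ A.graph ↔ ∀ a b, (a, b) ∈ A.graph → ⟪b, y⟫_𝕜 = ⟪a, z⟫_𝕜 := by
  conv_lhs => rw [← LinearPMap.isSelfAdjoint_def.1 hA]
  exact mem_graph_adjoint hA.dense_domain

theorem IsPositive.inner_symm {A : H →ₗ.[𝕜] H} (hA : IsPositive A) {a b c d : H}
    (h1 : (a, b) ∈ A.graph) (h2 : (c, d) ∈ A.graph) : ⟪b, c⟫_𝕜 = ⟪a, d⟫_𝕜 := by
  obtain ⟨ha, rfl⟩ := mk_mem_graph.1 h1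
  obtain ⟨hc, rfl⟩ := mk_mem_graph.1 h2
  exact hA.symm ⟨a, ha⟩ ⟨c, hc⟩

theorem IsPositive.re_inner_nonneg {A : H →ₗ.[𝕜] H} (hA : IsPositive A) {a b : H}
    (h : (a, b) ∈ A.graph) : 0 ≤ RCLike.re ⟪b, a⟫_𝕜 := by
  obtain ⟨ha, rfl⟩ := mk_mem_graph.1 h
  exact hA.nonneg ⟨a, ha⟩

theorem isPositive_of_graph {A : H →ₗ.[𝕜] H}
    (hs : ∀ a b c d, (a, b) ∈ A.graph → (c, d) ∈ A.graph → ⟪b, c⟫_𝕜 = ⟪a, d⟫_𝕜)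
    (hp : ∀ a b, (a, b) ∈ A.graph → 0 ≤ RCLike.re ⟪b, a⟫_𝕜) : IsPositive A where
  symm f g := hs _ _ _ _ (A.mem_graph f) (A.mem_graph g)
  nonneg f := hp _ _ (A.mem_graph f)

/-- A closed subspace of a product of Hilbert spaces is contained in the closure of a subspace
`M` of it, if none of its nonzero elements is orthogonal to `M`. -/
theorem le_topologicalClosure_of_orthogonal [CompleteSpace H] [CompleteSpace K]
    {M N : Submodule 𝕜 (H × K)} (hMN : M ≤ N) (hN : IsClosed (N : Set (H × K)))
    (h : ∀ x y, (x, y) ∈ N → (∀ a b, (a, b) ∈ M → ⟪a, x⟫_𝕜 + ⟪b, y⟫_𝕜 = 0) → x = 0 ∧ y = 0) :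
    N ≤ M.topologicalClosure := by
  -- `H × K` carries the sup norm; orthogonal projection takes place in the `ℓ²` product, which has
  -- the same topology.
  let e : WithLp 2 (H × K) →ₗ[𝕜] H × K := (WithLp.linearEquiv 2 𝕜 (H × K)).toLinearMap
  have he : Continuous e := WithLp.prod_continuous_ofLp 2 H K
  let P : Submodule 𝕜 (WithLp 2 (H × K)) := M.topologicalClosure.comap e
  have hP : IsClosed (P : Set (WithLp 2 (H × K))) := M.isClosed_topologicalClosure.preimage he
  have : CompleteSpace P := hP.completeSpace_coe
  have hPN : P ≤ N.comap e := Submodule.comap_mono (M.topologicalClosure_minimal hMN hN)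
  have hsup := Submodule.sup_orthogonal_inf_of_hasOrthogonalProjection hPN
  have hbot : Pᗮ ⊓ N.comap e = ⊥ := by
    rw [Submodule.eq_bot_iff]
    rintro p ⟨hp1, hp2⟩
    have := h p.fst p.snd hp2 fun a b hab => by
      have := (Submodule.mem_orthogonal _ _).1 hp1 (WithLp.toLp 2 (a, b))
        (M.le_topologicalClosure hab)
      simpa [WithLp.prod_inner_apply] using this
    exact (WithLp.linearEquiv 2 𝕜 (H × K)).injective (Prod.ext this.1 this.2)
  rw [hbot, sup_bot_eq] at hsup
  intro p hp
  have hq : WithLp.toLp 2 p ∈ N.comap e := hp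
  rw [← hsup] at hq
  exact hq

/-- The graph of the second adjoint is contained in the closure of the graph. -/
theorem graph_adjoint_adjoint_le [CompleteSpace H] [CompleteSpace K] {Q : H →ₗ.[𝕜] K}
    (hQ : Dense (Q.domain : Set H)) (hQ' : Dense (Q†.domain : Set K)) :
    Q††.graph ≤ Q.graph.topologicalClosure := by
  refine le_topologicalClosure_of_orthogonal ?_ (LinearPMap.adjoint_isClosed hQ') ?_
  · rintro ⟨x, y⟩ hxy
    rw [mem_graph_adjoint hQ']
    intro a b hab
    rw [mem_graph_adjoint hQ] at hab
    rw [← inner_conj_symm, ← hab x y hxy, inner_conj_symm]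
  · intro x y hxy h
    -- Orthogonality to the graph of `Q` puts the rotated pair in the graph of `Q*`; pairing it with
    -- `(x, y)` gives `-‖x‖² = ‖y‖²`.
    have h1 : (y, -x) ∈ Q†.graph := by
      rw [mem_graph_adjoint hQ]
      intro a b hab
      rw [inner_neg_right, eq_neg_iff_add_eq_zero, add_comm]
      exact h a b hab
    have h2 := (mem_graph_adjoint hQ').1 hxy _ _ h1
    rw [inner_neg_left, inner_self_eq_norm_sq_to_K, inner_self_eq_norm_sq_to_K] at h2
    have h3 : -‖x‖ ^ 2 = ‖y‖ ^ 2 := by exact_mod_cast h2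
    have hx : ‖x‖ = 0 := by nlinarith [sq_nonneg ‖x‖, sq_nonneg ‖y‖]
    have hy : ‖y‖ = 0 := by nlinarith [sq_nonneg ‖x‖, sq_nonneg ‖y‖]
    exact ⟨norm_eq_zero.1 hx, norm_eq_zero.1 hy⟩

end Graph

/-! ### The resolvent at `-1` and the unbounded square root. -/

section Resolvent

variable {𝕜 H : Type*} [RCLike 𝕜] [NormedAddCommGroup H] [InnerProductSpace 𝕜 H]

theorem norm_le_norm_add_of_re_inner_nonneg {x y : H} (h : 0 ≤ RCLike.re ⟪y, x⟫_𝕜) :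
    ‖x‖ ≤ ‖x + y‖ ∧ ‖y‖ ≤ ‖x + y‖ := by
  have h2 := norm_add_sq (𝕜 := 𝕜) x y
  rw [inner_re_symm] at h2
  constructor <;> refine le_of_sq_le_sq ?_ (norm_nonneg _) <;>
    nlinarith [sq_nonneg ‖x‖, sq_nonneg ‖y‖]

/-- The map `I + S`, on the graph of `S`. -/
def oneAdd (S : H →ₗ.[𝕜] H) : S.graph →L[𝕜] H :=
  (ContinuousLinearMap.fst 𝕜 H H + ContinuousLinearMap.snd 𝕜 H H).comp S.graph.subtypeL

theorem norm_le_norm_oneAdd {S : H →ₗ.[𝕜] H} (hp : IsPositive S) (p : S.graph) :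
    ‖p‖ ≤ ‖oneAdd S p‖ :=
  have h := norm_le_norm_add_of_re_inner_nonneg (hp.re_inner_nonneg p.2)
  max_le h.1 h.2

theorem oneAdd_injective {S : H →ₗ.[𝕜] H} (hp : IsPositive S) :
    Function.Injective (oneAdd S) := by
  rw [injective_iff_map_eq_zero]
  intro p h
  have := norm_le_norm_oneAdd hp p
  rwa [h, norm_zero, norm_le_zero_iff] at this

/-- `I + S` is bounded below on the closed graph, so its range is closed. A vector `v` orthogonal to
the range satisfies `S v = -v` by self-adjointness, and positivity forces `v = 0`. -/
theorem oneAdd_surjective [CompleteSpace H] {S : H →ₗ.[𝕜] H}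
    (hS : IsSelfAdjoint S) (hp : IsPositive S) :
    Function.Surjective (oneAdd S) := by
  have : CompleteSpace S.graph := hS.isClosed.completeSpace_coe
  have hcl : IsClosed (Set.range (oneAdd S)) :=
    (AddMonoidHomClass.antilipschitz_of_bound (oneAdd S) (K := 1)
      (by simpa using norm_le_norm_oneAdd hp)).isClosed_range (oneAdd S).uniformContinuous
  let P : Submodule 𝕜 H := LinearMap.range (oneAdd S).toLinearMap
  have : CompleteSpace P := hcl.completeSpace_coe
  have hP : P = ⊤ := by
    rw [← Submodule.orthogonal_eq_bot_iff, Submodule.eq_bot_iff]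
    intro v hv
    rw [Submodule.mem_orthogonal] at hv
    have hg : (v, -v) ∈ S.graph := by
      rw [mem_graph_of_isSelfAdjoint hS]
      intro a b hab
      have := hv (a + b) ⟨⟨(a, b), hab⟩, rfl⟩
      rw [inner_add_left] at this
      rw [inner_neg_right, eq_neg_iff_add_eq_zero, add_comm]
      exact this
    have := hp.re_inner_nonneg hg
    rw [inner_neg_left, map_neg, inner_self_eq_norm_sq] at this
    exact norm_eq_zero.1 (by nlinarith [sq_nonneg ‖v‖])
  intro u
  have hu : u ∈ P := hP ▸ Submodule.mem_top
  exact hu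

/-- The resolvent `B = (I + S)⁻¹`. -/
theorem exists_resolvent [CompleteSpace H] {S : H →ₗ.[𝕜] H}
    (hS : IsSelfAdjoint S) (hp : IsPositive S) :
    ∃ B : H →L[𝕜] H, IsSelfAdjoint B ∧ ‖B‖ ≤ 1 ∧ ‖1 - B‖ ≤ 1 ∧
      (∀ u, (B u, u - B u) ∈ S.graph) ∧ ∀ x y, (x, y) ∈ S.graph → B (x + y) = x := by
  let e : S.graph ≃ₗ[𝕜] H := LinearEquiv.ofBijective (oneAdd S).toLinearMap
    ⟨oneAdd_injective hp, oneAdd_surjective hS hp⟩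
  let B₀ : H →ₗ[𝕜] H := LinearMap.fst 𝕜 H H ∘ₗ S.graph.subtype ∘ₗ e.symm.toLinearMap
  have key : ∀ u, ∃ x y, (x, y) ∈ S.graph ∧ x + y = u ∧ B₀ u = x := fun u =>
    ⟨(e.symm u).1.1, (e.symm u).1.2, (e.symm u).2, e.apply_symm_apply u, rfl⟩
  have hbound : ∀ u, ‖B₀ u‖ ≤ 1 * ‖u‖ := fun u => by
    obtain ⟨x, y, hxy, rfl, h⟩ := key u
    rw [h, one_mul]
    exact (norm_le_norm_add_of_re_inner_nonneg (hp.re_inner_nonneg hxy)).1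
  refine ⟨B₀.mkContinuous 1 hbound, ?_, B₀.mkContinuous_norm_le zero_le_one hbound, ?_, ?_, ?_⟩
  · rw [ContinuousLinearMap.isSelfAdjoint_iff_isSymmetric]
    intro u v
    obtain ⟨x, y, hxy, rfl, h⟩ := key u
    obtain ⟨x', y', hxy', rfl, h'⟩ := key v
    change ⟪B₀ (x + y), x' + y'⟫_𝕜 = ⟪x + y, B₀ (x' + y')⟫_𝕜
    rw [h, h', inner_add_left, inner_add_right, hp.inner_symm hxy hxy']
  · refine ContinuousLinearMap.opNorm_le_bound _ zero_le_one fun u => ?_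
    obtain ⟨x, y, hxy, rfl, h⟩ := key u
    change ‖(x + y) - B₀ (x + y)‖ ≤ _
    rw [h, add_sub_cancel_left, one_mul]
    exact (norm_le_norm_add_of_re_inner_nonneg (hp.re_inner_nonneg hxy)).2
  · intro u
    obtain ⟨x, y, hxy, rfl, h⟩ := key u
    change (B₀ (x + y), (x + y) - B₀ (x + y)) ∈ _
    rwa [h, add_sub_cancel_left]
  · intro x y hxy
    have : e.symm (x + y) = ⟨(x, y), hxy⟩ := e.symm_apply_eq.2 rfl
    change (e.symm (x + y)).1.1 = x
    rw [this]

/-- The operator `D C⁻¹`, for an injective `C`. -/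
theorem exists_graph_eq {C D : H →L[𝕜] H} (hC : ∀ u, C u = 0 → u = 0) :
    ∃ R : H →ₗ.[𝕜] H, ∀ x y, (x, y) ∈ R.graph ↔ ∃ u, C u = x ∧ D u = y := by
  let G : Submodule 𝕜 (H × H) := LinearMap.range (C.toLinearMap.prod D.toLinearMap)
  have hG : ∀ x y, (x, y) ∈ G ↔ ∃ u, C u = x ∧ D u = y := fun x y => by
    simp [G, LinearMap.mem_range]
  refine ⟨G.toLinearPMap, fun x y => ?_⟩
  rw [Submodule.toLinearPMap_graph_eq _ ?_, hG]
  rintro ⟨x, y⟩ hx hx0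
  obtain ⟨u, h1, rfl⟩ := (hG x y).1 hx
  rw [hC u (h1.trans hx0)]
  exact map_zero D

/-- A positive self-adjoint operator has a positive self-adjoint square root. -/
theorem exists_isPosSqrt [CompleteSpace H] {S : H →ₗ.[𝕜] H}
    (hS : IsSelfAdjoint S) (hp : IsPositive S) :
    ∃ R : H →ₗ.[𝕜] H, IsPosSqrt R S := by
  obtain ⟨B, hB, hB0, hB1, hBS, hSB⟩ := exists_resolvent hS hp
  obtain ⟨C, D, hC, hD, hCC, hDD, hCD, hpos⟩ := exists_commuting_sqrts hB hB0 hB1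
  have hCs : ∀ x y, ⟪C x, y⟫_𝕜 = ⟪x, C y⟫_𝕜 := hC.isSymmetric
  have hDs : ∀ x y, ⟪D x, y⟫_𝕜 = ⟪x, D y⟫_𝕜 := hD.isSymmetric
  have hcc : ∀ x, C (C x) = B x := fun x => congrArg (· x) hCC
  have hdd : ∀ x, D (D x) = x - B x := fun x => congrArg (· x) hDD
  have hcd : ∀ x, C (D x) = D (C x) := fun x => congrArg (· x) hCD.eq
  -- As `C² + D² = 1`, a relation `D u = C z` is solved by `w = C u + D z`: then `u = C w`, and
  -- likewise `z = D w`.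
  have hsplit : ∀ {u z}, D u = C z → u = C (C u + D z) := fun {u z} h => by
    rw [map_add, hcc, hcd, ← h, hdd, add_sub_cancel]
  -- `B u = 0` puts `(0, u)` in the graph of `S`.
  have hinj : ∀ u, C u = 0 → u = 0 := fun u hu => by
    have hBu : B u = 0 := by rw [← hcc, hu, map_zero]
    have := hBS u
    rw [hBu, sub_zero] at this
    exact LinearPMap.graph_fst_eq_zero_snd S this rfl
  obtain ⟨R, hR⟩ := exists_graph_eq (D := D) hinj
  have hdense : Dense (R.domain : Set H) := by
    have hle : R.domain.topologicalClosure = ⊤ := by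
      rw [Submodule.topologicalClosure_eq_top_iff, Submodule.eq_bot_iff]
      intro v hv
      rw [Submodule.mem_orthogonal] at hv
      refine hinj v (ext_inner_left 𝕜 fun u => ?_)
      rw [← hCs, inner_zero_right]
      exact hv _ (LinearPMap.mem_domain_of_mem_graph ((hR _ _).2 ⟨u, rfl, rfl⟩))
    exact Submodule.dense_iff_topologicalClosure_eq_top.2 hle
  refine ⟨R, ?_, ?_, ?_⟩
  · rw [LinearPMap.isSelfAdjoint_def]
    refine LinearPMap.eq_of_eq_graph (SetLike.ext ?_)
    rintro ⟨y, z⟩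
    rw [mem_graph_adjoint hdense, hR]
    constructor
    · intro h
      have hDy : D y = C z := ext_inner_left 𝕜 fun u => by
        rw [← hDs, ← hCs]
        exact h _ _ ((hR _ _).2 ⟨u, rfl, rfl⟩)
      refine ⟨C y + D z, (hsplit hDy).symm, ?_⟩
      rw [map_add, ← hcd, hDy, hcc, hdd, add_sub_cancel]
    · rintro ⟨u, rfl, rfl⟩ a b hab
      obtain ⟨v, rfl, rfl⟩ := (hR _ _).1 hab
      rw [hDs, hCs, hcd]
  · refine isPositive_of_graph ?_ ?_
    · intro a b c d h1 h2
      obtain ⟨u, rfl, rfl⟩ := (hR _ _).1 h1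
      obtain ⟨v, rfl, rfl⟩ := (hR _ _).1 h2
      rw [hDs, hCs, hcd]
    · intro a b h
      obtain ⟨u, rfl, rfl⟩ := (hR _ _).1 h
      exact hpos u
  · refine LinearPMap.eq_of_eq_graph (SetLike.ext ?_)
    rintro ⟨x, z⟩
    rw [mem_graph_mul]
    simp only [hR]
    constructor
    · rintro ⟨_, ⟨u, rfl, rfl⟩, v, hv, rfl⟩
      have hu := hsplit hv.symm
      set w := C u + D v
      have hv' : v = D w := by
        have h0 : C (v - D w) = 0 := by rw [map_sub, hv, hcd, ← hu, sub_self]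
        exact sub_eq_zero.1 (hinj _ h0)
      rw [hu, hv', hcc, hdd]
      exact hBS w
    · intro h
      have hx := hSB x z h
      refine ⟨D (C (x + z)), ⟨C (x + z), by rw [hcc, hx], rfl⟩, D (x + z), hcd _, ?_⟩
      rw [hdd, hx, add_sub_cancel_left]

end Resolvent

/-! ### Comparing the energy operator with the restricted square root. -/

section Friedrichs

variable {𝕜 H : Type*} [RCLike 𝕜] [NormedAddCommGroup H] [InnerProductSpace 𝕜 H]

theorem exists_tendsto_of_norm_eq {V K L : Type*} [AddCommGroup V] [Module 𝕜 V]
    [NormedAddCommGroup K] [NormedSpace 𝕜 K] [NormedAddCommGroup L] [NormedSpace 𝕜 L]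
    [CompleteSpace L] {a : V →ₗ[𝕜] K} {b : V →ₗ[𝕜] L} (h : ∀ v, ‖a v‖ = ‖b v‖) {u : ℕ → V} {y : K}
    (hu : Tendsto (fun n => a (u n)) atTop (𝓝 y)) :
    ∃ z, Tendsto (fun n => b (u n)) atTop (𝓝 z) := by
  refine cauchySeq_tendsto_of_complete (Metric.cauchySeq_iff.2 fun ε hε => ?_)
  obtain ⟨N, hN⟩ := Metric.cauchySeq_iff.1 hu.cauchySeq ε hε
  refine ⟨N, fun m hm n hn => ?_⟩
  rw [dist_eq_norm, ← map_sub, ← h, map_sub, ← dist_eq_norm]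
  exact hN m hm n hn

theorem mem_ker_one_add {A : H →ₗ.[𝕜] H} {g : H} :
    g ∈ ker (one 𝕜 H + A) ↔ (g, -g) ∈ A.graph := by
  rw [mk_mem_graph]
  constructor
  · rintro ⟨⟨y, hy⟩, h0, rfl⟩
    refine ⟨hy.2, eq_neg_of_add_eq_zero_right ?_⟩
    exact LinearMap.mem_ker.1 h0
  · rintro ⟨hg, h⟩
    refine ⟨⟨g, Submodule.mem_top, hg⟩, LinearMap.mem_ker.2 ?_, rfl⟩
    change g + A ⟨g, hg⟩ = 0
    rw [h, add_neg_cancel]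

theorem isPosSqrt_sqrt [CompleteSpace H] {S : H →ₗ.[𝕜] H} (hS : IsSelfAdjoint S)
    (hp : IsPositive S) : IsPosSqrt (sqrt S) S := by
  have h := exists_isPosSqrt hS hp
  rw [sqrt, dif_pos h]
  exact h.choose_spec

theorem inner_energyOp {T : H →ₗ.[𝕜] H} (hd : Dense (T.domain : Set H)) (hT : IsPositive T)
    (f h : T.domain) :
    ⟪(energyOp T hd hT).toFun f, (energyOp T hd hT).toFun h⟫_𝕜 = ⟪T f, (h : H)⟫_𝕜 :=
  (UniformSpace.Completion.inner_coe _ _).trans (inner_toEnergyRange T hd hT f h)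

/-- The adjoint sends the class of `T h` to `T h`, so its domain contains `ran T`, dense in its
completion. -/
theorem dense_domain_adjoint_energyOp [CompleteSpace H] {T : H →ₗ.[𝕜] H}
    (hd : Dense (T.domain : Set H)) (hT : IsPositive T) :
    Dense ((energyOp T hd hT)†.domain : Set (EnergySpace T hd hT)) := by
  refine UniformSpace.Completion.denseRange_coe.mono ?_
  rintro _ ⟨u, rfl⟩
  obtain ⟨h, rfl⟩ := toEnergyRange_surjective T hd hT u
  refine LinearPMap.mem_adjoint_domain_of_exists _ ⟨T h, fun f => ?_⟩
  exact (inner_energyOp hd hT h f).symm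

theorem exists_seq_of_mem_closure_graph {K : Type*} [NormedAddCommGroup K] [InnerProductSpace 𝕜 K]
    {Q : H →ₗ.[𝕜] K} {x : H} {y : K} (h : (x, y) ∈ Q.graph.topologicalClosure) :
    ∃ u : ℕ → Q.domain, Tendsto (fun n => (u n : H)) atTop (𝓝 x) ∧
      Tendsto (fun n => Q.toFun (u n)) atTop (𝓝 y) := by
  obtain ⟨p, hp, hlim⟩ := mem_closure_iff_seq_limit.1 h
  choose hx hy using fun n => mk_mem_graph.1 (hp n)
  refine ⟨fun n => ⟨(p n).1, hx n⟩, (continuous_fst.tendsto _).comp hlim, ?_⟩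
  have h2 := (continuous_snd.tendsto _).comp hlim
  exact h2.congr fun n => (hy n).symm

variable [CompleteSpace H] {T S R : H →ₗ.[𝕜] H}

theorem IsPosSqrt.mem_graph_iff (hR : IsPosSqrt R S) {x z : H} :
    (x, z) ∈ S.graph ↔ ∃ y, (x, y) ∈ R.graph ∧ (y, z) ∈ R.graph := by
  rw [← hR.mul_self, mem_graph_mul]

theorem IsPosSqrt.domain_le (hR : IsPosSqrt R S) (hTS : T ≤ S) : T.domain ≤ R.domain :=
  fun x hx => by
    obtain ⟨y, hy, -⟩ := hR.mem_graph_iff.1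
      (LinearPMap.le_graph_of_le hTS (T.mem_graph ⟨x, hx⟩))
    exact LinearPMap.mem_domain_of_mem_graph hy

/-- The restriction of the square root `R` of `S` to the domain of a restriction `T` of `S`. -/
def IsPosSqrt.restrict (hR : IsPosSqrt R S) (hTS : T ≤ S) : H →ₗ.[𝕜] H where
  domain := T.domain
  toFun := R.toFun ∘ₗ Submodule.inclusion (hR.domain_le hTS)

theorem IsPosSqrt.mem_graph_restrict (hR : IsPosSqrt R S) (hTS : T ≤ S) (f : T.domain) :
    ((f : H), (hR.restrict hTS).toFun f) ∈ R.graph :=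
  mk_mem_graph.2 ⟨hR.domain_le hTS f.2, rfl⟩

theorem IsPosSqrt.restrict_mem_graph (hR : IsPosSqrt R S) (hTS : T ≤ S) (f : T.domain) :
    ((hR.restrict hTS).toFun f, T f) ∈ R.graph := by
  obtain ⟨y, h1, h2⟩ := hR.mem_graph_iff.1 (LinearPMap.le_graph_of_le hTS (T.mem_graph f))
  rwa [LinearPMap.mem_graph_snd_inj R (hR.mem_graph_restrict hTS f) h1 rfl]

/-- Symmetry of `R` moves one factor across, since `R f` lies in `dom R` with `R (R f) = T f`. It
matters that `g` need only lie in `dom R`. -/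
theorem IsPosSqrt.inner_restrict (hR : IsPosSqrt R S) (hTS : T ≤ S) (f : T.domain) {g k : H}
    (h : (g, k) ∈ R.graph) : ⟪(hR.restrict hTS).toFun f, k⟫_𝕜 = ⟪T f, g⟫_𝕜 :=
  (hR.pos.inner_symm (hR.restrict_mem_graph hTS f) h).symm

theorem IsPosSqrt.inner_energyOp (hR : IsPosSqrt R S) (hTS : T ≤ S)
    (hd : Dense (T.domain : Set H)) (hT : IsPositive T) (f h : T.domain) :
    ⟪(energyOp T hd hT).toFun f, (energyOp T hd hT).toFun h⟫_𝕜 =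
      ⟪(hR.restrict hTS).toFun f, (hR.restrict hTS).toFun h⟫_𝕜 := by
  rw [UnboundedOp.inner_energyOp, hR.inner_restrict hTS f (hR.mem_graph_restrict hTS h)]

theorem IsPosSqrt.norm_energyOp (hR : IsPosSqrt R S) (hTS : T ≤ S)
    (hd : Dense (T.domain : Set H)) (hT : IsPositive T) (f : T.domain) :
    ‖(energyOp T hd hT).toFun f‖ = ‖(hR.restrict hTS).toFun f‖ := by
  rw [@norm_eq_sqrt_re_inner 𝕜, @norm_eq_sqrt_re_inner 𝕜, hR.inner_energyOp hTS]

theorem IsPosSqrt.inner_limit (hR : IsPosSqrt R S) (hTS : T ≤ S)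
    (hd : Dense (T.domain : Set H)) (hT : IsPositive T) {u : ℕ → T.domain}
    {j : EnergySpace T hd hT} {c : H}
    (hj : Tendsto (fun n => (energyOp T hd hT).toFun (u n)) atTop (𝓝 j))
    (hc : Tendsto (fun n => (hR.restrict hTS).toFun (u n)) atTop (𝓝 c)) (f : T.domain) :
    ⟪(energyOp T hd hT).toFun f, j⟫_𝕜 = ⟪(hR.restrict hTS).toFun f, c⟫_𝕜 := by
  refine tendsto_nhds_unique (tendsto_const_nhds.inner hj) ?_
  simp only [hR.inner_energyOp hTS]
  exact tendsto_const_nhds.inner hc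

theorem IsPosSqrt.mem_graph_of_tendsto (hR : IsPosSqrt R S) (hTS : T ≤ S) {u : ℕ → T.domain}
    {x c : H} (hx : Tendsto (fun n => (u n : H)) atTop (𝓝 x))
    (hc : Tendsto (fun n => (hR.restrict hTS).toFun (u n)) atTop (𝓝 c)) : (x, c) ∈ R.graph :=
  IsClosed.mem_of_tendsto hR.selfAdjoint.isClosed (hx.prodMk_nhds hc)
    (Eventually.of_forall fun n => hR.mem_graph_restrict hTS (u n))

theorem exists_seq_of_mem_graph_adjoint_adjoint (hd : Dense (T.domain : Set H))
    (hT : IsPositive T) {x : H} {j : EnergySpace T hd hT}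
    (h : (x, j) ∈ (energyOp T hd hT)††.graph) :
    ∃ u : ℕ → T.domain, Tendsto (fun n => (u n : H)) atTop (𝓝 x) ∧
      Tendsto (fun n => (energyOp T hd hT).toFun (u n)) atTop (𝓝 j) :=
  exists_seq_of_mem_closure_graph
    (graph_adjoint_adjoint_le (Q := energyOp T hd hT) hd (dense_domain_adjoint_energyOp hd hT) h)

/-- If `S` is the Friedrichs extension of `T`, then `ker (I + T*) ∩ dom S^{1/2} = 0`. -/
theorem IsPosSqrt.ker_inf_domain_eq_bot (hR : IsPosSqrt R S) (hTS : T ≤ S)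
    (hd : Dense (T.domain : Set H)) (hT : IsPositive T) (hS : IsSelfAdjoint S)
    (hSpos : IsPositive S) (h : S = friedrichs T hd hT) :
    ker (one 𝕜 H + T†) ⊓ R.domain = ⊥ := by
  rw [Submodule.eq_bot_iff]
  rintro g ⟨hg, hgR⟩
  rw [SetLike.mem_coe, mem_ker_one_add, mem_graph_adjoint hd] at hg
  -- `⟪S x, g⟫ = ⟪R x, R g⟫` is the limit of `⟪R uₙ, R g⟫ = ⟪T uₙ, g⟫ = -⟪uₙ, g⟫`, hence equals
  -- `-⟪x, g⟫`.
  have horth : ∀ x s, (x, s) ∈ S.graph → ⟪x + s, g⟫_𝕜 = 0 := by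
    intro x s hxs
    have hxs' := hxs
    rw [h, friedrichs, mem_graph_mul] at hxs'
    obtain ⟨j, hxj, -⟩ := hxs'
    obtain ⟨u, hux, huj⟩ := exists_seq_of_mem_graph_adjoint_adjoint hd hT hxj
    obtain ⟨z, huz⟩ := exists_tendsto_of_norm_eq (hR.norm_energyOp hTS hd hT) huj
    have hxz := hR.mem_graph_of_tendsto hTS hux huz
    obtain ⟨c, hxc, hcs⟩ := hR.mem_graph_iff.1 hxs
    obtain rfl := LinearPMap.mem_graph_snd_inj R hxz hxc rfl
    have hgk := R.mem_graph ⟨g, hgR⟩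
    have hlim : ⟪z, R ⟨g, hgR⟩⟫_𝕜 = ⟪x, -g⟫_𝕜 := by
      refine tendsto_nhds_unique (huz.inner tendsto_const_nhds) ?_
      refine (hux.inner tendsto_const_nhds).congr fun n => ?_
      exact ((hR.inner_restrict hTS (u n) hgk).trans (hg _ _ (T.mem_graph (u n)))).symm
    rw [inner_add_left, hR.pos.inner_symm hcs hgk, hlim, inner_neg_right, add_neg_cancel]
  obtain ⟨p, hp⟩ := oneAdd_surjective hS hSpos g
  have := horth _ _ p.2
  change ⟪oneAdd S p, g⟫_𝕜 = 0 at this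
  rwa [hp, inner_self_eq_zero] at this

/-- If `ker (I + T*) ∩ dom S^{1/2} = 0`, then `dom T` is a core of `S^{1/2}`. -/
theorem IsPosSqrt.graph_le_closure (hR : IsPosSqrt R S) (hTS : T ≤ S)
    (hd : Dense (T.domain : Set H)) (h : ker (one 𝕜 H + T†) ⊓ R.domain = ⊥) :
    R.graph ≤ (hR.restrict hTS).graph.topologicalClosure := by
  refine le_topologicalClosure_of_orthogonal ?_ hR.selfAdjoint.isClosed ?_
  · rintro ⟨x, y⟩ hxy
    obtain ⟨hx, rfl⟩ := mk_mem_graph.1 hxy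
    exact hR.mem_graph_restrict hTS ⟨x, hx⟩
  · intro g k hgk horth
    have hg : g ∈ ker (one 𝕜 H + T†) ⊓ R.domain := by
      refine ⟨mem_ker_one_add.2 ((mem_graph_adjoint hd).2 ?_),
        LinearPMap.mem_domain_of_mem_graph hgk⟩
      intro a b hab
      obtain ⟨ha, rfl⟩ := mk_mem_graph.1 hab
      rw [← hR.inner_restrict hTS ⟨a, ha⟩ hgk, inner_neg_right, eq_neg_iff_add_eq_zero, add_comm]
      exact horth _ _ (mk_mem_graph.2 ⟨ha, rfl⟩)
    rw [h, Submodule.mem_bot] at hg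
    exact ⟨hg, LinearPMap.graph_fst_eq_zero_snd R hgk hg⟩

/-- If `ker (I + T*) ∩ dom S^{1/2} = 0`, then `S` is the Friedrichs extension of `T`. -/
theorem IsPosSqrt.eq_friedrichs (hR : IsPosSqrt R S) (hTS : T ≤ S)
    (hd : Dense (T.domain : Set H)) (hT : IsPositive T)
    (h : ker (one 𝕜 H + T†) ⊓ R.domain = ⊥) : S = friedrichs T hd hT := by
  have hcore := hR.graph_le_closure hTS hd h
  have hQ' := dense_domain_adjoint_energyOp hd hT
  refine LinearPMap.eq_of_eq_graph (SetLike.ext ?_)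
  rintro ⟨x, z⟩
  rw [hR.mem_graph_iff, friedrichs, mem_graph_mul]
  constructor
  · rintro ⟨c, hxc, hcz⟩
    obtain ⟨u, hux, huc⟩ := exists_seq_of_mem_closure_graph (hcore hxc)
    obtain ⟨j, huj⟩ := exists_tendsto_of_norm_eq
      (fun v => (hR.norm_energyOp hTS hd hT v).symm) huc
    refine ⟨j, ?_, ?_⟩
    -- `Q**` is closed and extends `Q`.
    · refine IsClosed.mem_of_tendsto (LinearPMap.adjoint_isClosed hQ') (hux.prodMk_nhds huj)
        (Eventually.of_forall fun n => ?_)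
      refine (mem_graph_adjoint hQ').2 fun a b hab => ?_
      rw [← inner_conj_symm,
        ← (mem_graph_adjoint (A := energyOp T hd hT) hd).1 hab _ _ (mk_mem_graph.2 ⟨(u n).2, rfl⟩),
        inner_conj_symm]
      rfl
    · refine (mem_graph_adjoint (A := energyOp T hd hT) hd).2 fun a b hab => ?_
      obtain ⟨ha, rfl⟩ := mk_mem_graph.1 hab
      exact (hR.inner_limit hTS hd hT huj huc ⟨a, ha⟩).trans
        (hR.pos.inner_symm (hR.mem_graph_restrict hTS ⟨a, ha⟩) hcz)
  · rintro ⟨j, hxj, hjz⟩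
    obtain ⟨u, hux, huj⟩ := exists_seq_of_mem_graph_adjoint_adjoint hd hT hxj
    obtain ⟨c, huc⟩ := exists_tendsto_of_norm_eq (hR.norm_energyOp hTS hd hT) huj
    refine ⟨c, hR.mem_graph_of_tendsto hTS hux huc, ?_⟩
    refine (mem_graph_of_isSelfAdjoint hR.selfAdjoint).2 fun a b hab => ?_
    -- The core property reduces the test against `R` to `v` in `dom T`, where `⟪R v, c⟫ = ⟪Q v, j⟫
    -- = ⟪v, z⟫`.
    obtain ⟨v, hva, hvb⟩ := exists_seq_of_mem_closure_graph (hcore hab)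
    refine tendsto_nhds_unique (hvb.inner tendsto_const_nhds) ?_
    refine (hva.inner tendsto_const_nhds).congr fun n => ?_
    exact (((mem_graph_adjoint (A := energyOp T hd hT) hd).1 hjz _ _
      (mk_mem_graph.2 ⟨(v n).2, rfl⟩)).symm.trans
        (hR.inner_limit hTS hd hT huj huc (v n)))

end Friedrichs

end UnboundedOp

end

theorem mainTheorem6 {𝕜 H : Type*} [RCLike 𝕜] [NormedAddCommGroup H] [InnerProductSpace 𝕜 H]
    [CompleteSpace H] (T S : H →ₗ.[𝕜] H)
    (hd : Dense (T.domain : Set H)) (hT : UnboundedOp.IsPositive T)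
    (hS : IsSelfAdjoint S) (hSpos : UnboundedOp.IsPositive S) (hTS : T ≤ S) :
    S = UnboundedOp.friedrichs T hd hT ↔
      UnboundedOp.ker (UnboundedOp.one 𝕜 H + T†) ⊓ (UnboundedOp.sqrt S).domain = ⊥ := by
  have hR := UnboundedOp.isPosSqrt_sqrt hS hSpos
  exact ⟨hR.ker_inf_domain_eq_bot hTS hd hT hS hSpos, hR.eq_friedrichs hTS hd hT⟩
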